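/- Let $\Sigma=\{X,N,S,R\}$ and let $\phi:\Sigma^*\to \mathrm{GL}(2,\mathbb{Z})$ be the monoid morphism with \[ \phi(X)=\begin{bmatrix} -1 & 0\\ 0 & -1\end{bmatrix},\quad \phi(N)=\begin{bmatrix} 1 & 0\\ 0 & -1\end{bmatrix},\quad \phi(S)=\begin{bmatrix} 0 & -1\\ 1 & 0\end{bmatrix},\quad \phi(R)=\begin{bmatrix} 0 & -1\\ 1 & 1\end{bmatrix}. \] A subset $\mathcal{S}\subseteq\mathrm{GL}(2,\mathbb{Z})$ is called regular if $\mathcal{S}=\phi(L)$ for some regular language $L\subseteq\Sigma^*$; it is given by a finite (nondeterministic) automaton that recognizes such an $L$. There is an algorithm that, given two nonsingular matrices $M_1,M_2\in\mathbb{Z}^{2\times 2}$ and two regular subsets $\mathcal{S}_1,\mathcal{S}_2$ of $\mathrm{GL}(2,\mathbb{Z})$ (by finite automata, possibly with $\varepsilon$-transitions), decides whether there exist matrices $A_1\in\mathcal{S}_1$ and $A_2\in\mathcal{S}_2$ such that $A_1M_1A_2=M_2$. -/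

import Mathlib

/-- The alphabet `Σ = {X, N, S, R}`. -/
inductive Letter where
  | X | N | S | R
  deriving DecidableEq

namespace Letter

/-- The four letters numbered `0, 1, 2, 3`. -/
def equivFin : Letter ≃ Fin 4 where
  toFun
    | X => 0
    | N => 1
    | S => 2
    | R => 3
  invFun i := ![X, N, S, R] i
  left_inv a := by cases a <;> rfl
  right_inv i := by fin_cases i <;> rfl

instance : Fintype Letter := Fintype.ofEquiv _ equivFin.symm

instance : Primcodable Letter := Primcodable.ofEquiv (Fin 4) equivFin

/-- The matrix in `GL(2, ℤ)` coded by a letter (given together with its inverse). -/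
def toGL : Letter → GL (Fin 2) ℤ
  | X => ⟨!![-1, 0; 0, -1], !![-1, 0; 0, -1], by decide, by decide⟩
  | N => ⟨!![1, 0; 0, -1], !![1, 0; 0, -1], by decide, by decide⟩
  | S => ⟨!![0, -1; 1, 0], !![0, 1; -1, 0], by decide, by decide⟩
  | R => ⟨!![0, -1; 1, 1], !![1, 1; -1, 0], by decide, by decide⟩

end Letter

/-- The morphism `φ : Σ* → GL(2, ℤ)`. -/
def wordToGL (w : List Letter) : GL (Fin 2) ℤ := (w.map Letter.toGL).prod

/-- A subset of `GL(2, ℤ)` is regular if it is the image under `φ` of a regular language. -/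
def IsRegularSubset (T : Set (GL (Fin 2) ℤ)) : Prop :=
  ∃ L : Language Letter, L.IsRegular ∧ T = {A | ∃ w ∈ L, wordToGL w = A}

/-- A finite description of a nondeterministic automaton over `Σ` with `ε`-transitions: the number
of states, the list of transitions `(s, a, t)` (where `a = none` stands for an `ε`-transition), the
list of initial states and the list of accepting states. The states are the numbers `< numStates`;
list entries that mention other numbers have no effect. -/
structure Automaton where
  numStates : ℕ
  transitions : List (ℕ × Option Letter × ℕ)
  start : List ℕ
  accept : List ℕ

namespace Automaton

/-- A description is a quadruple of numbers and lists. -/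
def equivProd : Automaton ≃ ℕ × List (ℕ × Option Letter × ℕ) × List ℕ × List ℕ where
  toFun 𝒜 := (𝒜.numStates, 𝒜.transitions, 𝒜.start, 𝒜.accept)
  invFun p := ⟨p.1, p.2.1, p.2.2.1, p.2.2.2⟩
  left_inv _ := rfl
  right_inv _ := rfl

instance : Primcodable Automaton := Primcodable.ofEquiv _ equivProd

/-- The automaton that a description describes. -/
def toεNFA (𝒜 : Automaton) : εNFA Letter (Fin 𝒜.numStates) where
  step s a := {t | ((s : ℕ), a, (t : ℕ)) ∈ 𝒜.transitions}
  start := {s | (s : ℕ) ∈ 𝒜.start}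
  accept := {s | (s : ℕ) ∈ 𝒜.accept}

/-- The language that an automaton recognizes. -/
def language (𝒜 : Automaton) : Language Letter := 𝒜.toεNFA.accepts

/-- The subset `φ(L(𝒜))` of `GL(2, ℤ)` that an automaton represents. -/
def subset (𝒜 : Automaton) : Set (GL (Fin 2) ℤ) := {A | ∃ w ∈ 𝒜.language, wordToGL w = A}

theorem isRegular_language (𝒜 : Automaton) : 𝒜.language.IsRegular := by
  refine ⟨_, inferInstance, 𝒜.toεNFA.toNFA.toDFA, ?_⟩
  rw [NFA.toDFA_correct, εNFA.toNFA_correct, language]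

theorem exists_language_eq {L : Language Letter} (hL : L.IsRegular) :
    ∃ 𝒜 : Automaton, 𝒜.language = L := by
  classical
  obtain ⟨σ, _, M, rfl⟩ := hL
  let M' := DFA.reindex (Fintype.equivFin σ) M
  let 𝒜 : Automaton :=
    { numStates := Fintype.card σ
      transitions := (Finset.univ : Finset (Fin (Fintype.card σ) × Letter)).toList.map
        fun p => ((p.1 : ℕ), some p.2, (M'.step p.1 p.2 : ℕ))
      start := [(M'.start : ℕ)]
      accept := ((Finset.univ : Finset (Fin (Fintype.card σ))).filter (· ∈ M'.accept)).toList.map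
        fun s => (s : ℕ) }
  refine ⟨𝒜, ?_⟩
  have h : 𝒜.toεNFA = M'.toNFA.toεNFA := by
    have h1 : 𝒜.toεNFA.step = M'.toNFA.toεNFA.step := by
      funext s a
      ext t
      cases a with
      | none => simp [toεNFA, NFA.toεNFA, 𝒜]
      | some a =>
        simp [toεNFA, NFA.toεNFA, DFA.toNFA, 𝒜, Fin.val_inj, eq_comm]
    have h2 : 𝒜.toεNFA.start = M'.toNFA.toεNFA.start := by
      ext t
      simp [toεNFA, NFA.toεNFA, DFA.toNFA, 𝒜, Fin.val_inj]
    have h3 : 𝒜.toεNFA.accept = M'.toNFA.toεNFA.accept := by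
      ext t
      simp [toεNFA, NFA.toεNFA, DFA.toNFA, 𝒜, Fin.val_inj]
    exact (εNFA.mk.injEq _ _ _ _ _ _).mpr ⟨h1, h2, h3⟩
  rw [language, h, NFA.toεNFA_correct, DFA.toNFA_correct]
  exact DFA.accepts_reindex M _

end Automaton

/-- The regular subsets of `GL(2, ℤ)` are exactly the subsets represented by automata. -/
theorem isRegularSubset_iff_exists_automaton (T : Set (GL (Fin 2) ℤ)) :
    IsRegularSubset T ↔ ∃ 𝒜 : Automaton, 𝒜.subset = T := by
  constructor
  · rintro ⟨L, hL, rfl⟩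
    obtain ⟨𝒜, rfl⟩ := Automaton.exists_language_eq hL
    exact ⟨𝒜, rfl⟩
  · rintro ⟨𝒜, rfl⟩
    exact ⟨𝒜.language, 𝒜.isRegular_language, rfl⟩

instance : Primcodable (Matrix (Fin 2) (Fin 2) ℤ) :=
  inferInstanceAs (Primcodable (Fin 2 → Fin 2 → ℤ))

/-! Both the solvability and the unsolvability of an instance have finite certificates that can be
checked primitive recursively, so a parallel search for the two kinds decides the problem
(`exists_computable_of_certificates`). A certificate of solvability is essentially an accepting run
of the two automata (`exists_solves_iff`). The substance is the certificate of unsolvability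
(`exists_refutes_iff`).

It rests on two facts. First, left multiplication by `GL(2, ℤ)` has only finitely many orbits on
integer matrices of determinant `±d`, for `d ≠ 0`. While the second automaton reads `A₂`, the matrix
`M₁ A₂` can therefore be kept in the form `G H` with `H` in a finite set of representatives, chosen
so that `M₂` represents its own orbit. The equation `A₁ M₁ A₂ = M₂` then forces `H = M₂` and `A₁ G =
1`, and solvability becomes a question about paths with label product `1` in a finite labelled
graph.

Second, `GL(2, ℤ)` is the amalgam of dihedral groups of orders 8 and 12 over their intersection of
order 4. By ping-pong, a word of length at least two over the factors with product `1` has two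
neighbours whose product is again in a factor (`exists_split_of_prod_eq_one`). Hence in a finite
edge set closed under such compositions, every nonempty path with product `1` shrinks to a single
edge labelled `1` (`LabelPath.one_mem_of_prod_eq_one`). The absence of the corresponding edges from
a closed set refutes solvability. Conversely, the edges realized by actual runs form such a closed
set, and it avoids those edges when there is no solution (`exists_refutes`). -/

/-! ### Primitive recursive list predicates, integer and matrix arithmetic -/

theorem PrimrecPred.forall_mem {α β : Type*} [Primcodable α] [Primcodable β] {f : α → List β}
    {R : α → β → Prop} (hf : Primrec f) (hR : PrimrecPred fun p : α × β => R p.1 p.2) :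
    PrimrecPred fun a => ∀ b ∈ f a, R a b :=
  (PrimrecRel.forall_mem_list (R := fun b a => R a b)
    (hR.comp (Primrec.snd.pair Primrec.fst)).primrecRel).comp hf Primrec.id

theorem PrimrecPred.exists_mem {α β : Type*} [Primcodable α] [Primcodable β] {f : α → List β}
    {R : α → β → Prop} (hf : Primrec f) (hR : PrimrecPred fun p : α × β => R p.1 p.2) :
    PrimrecPred fun a => ∃ b ∈ f a, R a b :=
  (PrimrecRel.exists_mem_list (R := fun b a => R a b)
    (hR.comp (Primrec.snd.pair Primrec.fst)).primrecRel).comp hf Primrec.id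

theorem PrimrecPred.mem_list {α β : Type*} [Primcodable α] [Primcodable β] {f : α → List β}
    {g : α → β} (hf : Primrec f) (hg : Primrec g) : PrimrecPred fun a => g a ∈ f a :=
  (PrimrecPred.exists_mem (R := fun a b => b = g a) hf
    (Primrec.eq.comp Primrec.snd (hg.comp Primrec.fst))).of_eq fun a => by simp

theorem PrimrecPred.imp {α : Type*} [Primcodable α] {p q : α → Prop} (hp : PrimrecPred p)
    (hq : PrimrecPred q) : PrimrecPred fun a => p a → q a := by
  classical
  exact (hp.not.or hq).of_eq fun a => by tauto

/-- The code of `n ≥ 0` is `2n` and that of `-(n + 1)` is `2n + 1`, so the parity of the code is the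
sign. -/
theorem Primrec.int_toNat : Primrec Int.toNat := by
  have h : Primrec fun z : ℤ => bif (Encodable.encode z).bodd then 0 else (Encodable.encode z).div2 :=
    Primrec.cond (Primrec.nat_bodd.comp Primrec.encode) (Primrec.const 0)
      (Primrec.nat_div2.comp Primrec.encode)
  refine h.of_eq fun z => ?_
  have e : Encodable.encode z = Equiv.intEquivNat z := rfl
  rw [e]
  rcases z with n | n
  · have : Equiv.intEquivNat (Int.ofNat n) = 2 * n := rfl
    rw [this]
    simp
  · have : Equiv.intEquivNat (Int.negSucc n) = 2 * n + 1 := rfl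
    simp [this]

theorem Primrec.int_subNatNat : Primrec₂ fun m n : ℕ => (m : ℤ) - n := by
  have h : Primrec fun p : ℕ × ℕ =>
      Denumerable.ofNat ℤ (if p.2 ≤ p.1 then 2 * (p.1 - p.2) else 2 * (p.2 - p.1 - 1) + 1) :=
    (Primrec.ofNat ℤ).comp (Primrec.ite (Primrec.nat_le.comp Primrec.snd Primrec.fst)
      (Primrec.nat_double.comp (Primrec.nat_sub.comp Primrec.fst Primrec.snd))
      (Primrec.nat_double_succ.comp (Primrec.nat_sub.comp
        (Primrec.nat_sub.comp Primrec.snd Primrec.fst) (Primrec.const 1))))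
  refine h.of_eq fun ⟨m, n⟩ => ?_
  have e0 (k : ℕ) : Encodable.encode (k : ℤ) = 2 * k := rfl
  have e1 (k : ℕ) : Encodable.encode (Int.negSucc k) = 2 * k + 1 := rfl
  dsimp only
  split_ifs with hle
  · rw [← e0, Denumerable.ofNat_encode]; omega
  · rw [← e1, Denumerable.ofNat_encode]; omega

/-- For `n > 0` the codes of `-n` and `n` are the neighbours `2n - 1` and `2n`; zero is fixed
because the predecessor on `ℕ` truncates. -/
theorem Primrec.int_neg : Primrec fun z : ℤ => -z := by
  have h : Primrec fun z : ℤ => Denumerable.ofNat ℤ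
      (bif (Encodable.encode z).bodd then Encodable.encode z + 1 else Encodable.encode z - 1) :=
    (Primrec.ofNat ℤ).comp (Primrec.cond (Primrec.nat_bodd.comp Primrec.encode)
      (Primrec.succ.comp Primrec.encode) (Primrec.pred.comp Primrec.encode))
  refine h.of_eq fun z => ?_
  have e0 (k : ℕ) : Encodable.encode (k : ℤ) = 2 * k := rfl
  have e1 (k : ℕ) : Encodable.encode (Int.negSucc k) = 2 * k + 1 := rfl
  rcases z with n | n
  · rw [Int.ofNat_eq_natCast, e0]
    rcases n with _ | n
    · rfl
    · have : 2 * (n + 1) - 1 = Encodable.encode (Int.negSucc n) := by rw [e1]; omega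
      have hb : (2 * (n + 1)).bodd = false := by simp
      rw [hb, cond_false, this, Denumerable.ofNat_encode]; omega
  · have : 2 * n + 1 + 1 = Encodable.encode ((n + 1 : ℕ) : ℤ) := by rw [e0]; omega
    have hb : (2 * n + 1).bodd = true := by simp
    rw [e1, hb, cond_true, this, Denumerable.ofNat_encode]; omega

theorem Primrec.int_add : Primrec₂ fun a b : ℤ => a + b := by
  have hn {f : ℤ × ℤ → ℤ} (hf : Primrec f) := Primrec.int_toNat.comp hf
  have hm {f : ℤ × ℤ → ℤ} (hf : Primrec f) := hn (Primrec.int_neg.comp hf)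
  refine (Primrec.int_subNatNat.comp (Primrec.nat_add.comp (hn .fst) (hn .snd))
    (Primrec.nat_add.comp (hm .fst) (hm .snd))).of_eq fun ⟨a, b⟩ => ?_
  dsimp only; omega

theorem Primrec.int_mul : Primrec₂ fun a b : ℤ => a * b := by
  have hn {f : ℤ × ℤ → ℤ} (hf : Primrec f) := Primrec.int_toNat.comp hf
  have hm {f : ℤ × ℤ → ℤ} (hf : Primrec f) := hn (Primrec.int_neg.comp hf)
  refine (Primrec.int_subNatNat.comp
    (Primrec.nat_add.comp (Primrec.nat_mul.comp (hn .fst) (hn .snd))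
      (Primrec.nat_mul.comp (hm .fst) (hm .snd)))
    (Primrec.nat_add.comp (Primrec.nat_mul.comp (hn .fst) (hm .snd))
      (Primrec.nat_mul.comp (hm .fst) (hn .snd)))).of_eq fun ⟨a, b⟩ => ?_
  dsimp only
  -- Expanding the product of two differences of natural numbers reduces multiplication to `ℕ`.
  have ha : a = (a.toNat : ℤ) - (-a).toNat := by omega
  have hb : b = (b.toNat : ℤ) - (-b).toNat := by omega
  conv_rhs => rw [ha, hb]
  push_cast
  ring

theorem PrimrecPred.int_dvd : PrimrecRel fun a b : ℤ => a ∣ b := by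
  have hn {f : ℤ × ℤ → ℤ} (hf : Primrec f) : Primrec fun p => (f p).natAbs :=
    (Primrec.nat_add.comp (Primrec.int_toNat.comp hf)
      (Primrec.int_toNat.comp (Primrec.int_neg.comp hf))).of_eq fun p => by omega
  refine (Primrec.eq.comp (Primrec.nat_mod.comp (hn .snd) (hn .fst)) (Primrec.const 0)).of_eq
    fun p => ?_
  rw [← Nat.dvd_iff_mod_eq_zero, Int.natAbs_dvd_natAbs]

namespace Primrec

theorem matrix_entry (i j : Fin 2) : Primrec fun M : Matrix (Fin 2) (Fin 2) ℤ => M i j := by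
  have h : Primrec₂ (@id (Fin 2 → Fin 2 → ℤ)) := Primrec.fin_app
  have h' : Primrec₂ (@id (Fin 2 → ℤ)) := Primrec.fin_app
  exact h'.comp (h.comp Primrec.id (Primrec.const i)) (Primrec.const j)

theorem matrix_of {α : Type*} [Primcodable α] {f : α → Matrix (Fin 2) (Fin 2) ℤ}
    (hf : ∀ i j, Primrec fun a => f a i j) : Primrec f := by
  have h : Primrec (fun a => (f a : Fin 2 → Fin 2 → ℤ)) :=
    Primrec.fin_curry.2 (Primrec₂.swap (Primrec.fin_curry₁.2 fun i =>
      Primrec.fin_curry.2 (Primrec₂.swap (Primrec.fin_curry₁.2 fun j => hf i j))))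
  exact h

theorem matrix_mul : Primrec₂ fun A B : Matrix (Fin 2) (Fin 2) ℤ => A * B := by
  refine Primrec.matrix_of fun i j => ?_
  simp only [Matrix.mul_apply, Fin.sum_univ_two]
  exact Primrec.int_add.comp
    (Primrec.int_mul.comp ((matrix_entry _ _).comp .fst) ((matrix_entry _ _).comp .snd))
    (Primrec.int_mul.comp ((matrix_entry _ _).comp .fst) ((matrix_entry _ _).comp .snd))

theorem matrix_adjugate : Primrec fun A : Matrix (Fin 2) (Fin 2) ℤ => A.adjugate := by
  refine Primrec.matrix_of fun i j => ?_
  simp only [Matrix.adjugate_fin_two]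
  fin_cases i <;> fin_cases j <;> simp <;>
    first
    | exact matrix_entry _ _
    | exact Primrec.int_neg.comp (matrix_entry _ _)

theorem matrix_det : Primrec fun A : Matrix (Fin 2) (Fin 2) ℤ => A.det := by
  simp only [Matrix.det_fin_two, sub_eq_add_neg]
  exact Primrec.int_add.comp
    (Primrec.int_mul.comp (matrix_entry _ _) (matrix_entry _ _))
    (Primrec.int_neg.comp (Primrec.int_mul.comp (matrix_entry _ _) (matrix_entry _ _)))

end Primrec

/-! ### The amalgam structure of `GL(2, ℤ)` by ping-pong on the plane -/

/-- The dihedral group of order 8 generated by `S` and `N`. -/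
def vertexGroupFour : List (Matrix (Fin 2) (Fin 2) ℤ) :=
  [!![1, 0; 0, 1], !![-1, 0; 0, -1], !![0, 1; 1, 0], !![0, -1; -1, 0],
    !![1, 0; 0, -1], !![-1, 0; 0, 1], !![0, -1; 1, 0], !![0, 1; -1, 0]]

/-- The dihedral group of order 12 that contains `R` and `-1`. -/
def vertexGroupSix : List (Matrix (Fin 2) (Fin 2) ℤ) :=
  [!![1, 0; 0, 1], !![-1, 0; 0, -1], !![0, 1; 1, 0], !![0, -1; -1, 0],
    !![0, -1; 1, 1], !![0, 1; -1, -1], !![1, 1; -1, 0], !![-1, -1; 1, 0],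
    !![1, 1; 0, -1], !![-1, -1; 0, 1], !![-1, 0; 1, 1], !![1, 0; -1, -1]]

/-- The factors of the amalgam decomposition of `GL(2, ℤ)`, put together. -/
def amalgamFactors : List (Matrix (Fin 2) (Fin 2) ℤ) := vertexGroupFour ++ vertexGroupSix

/-- The `ℓ¹` norm of a vector of the plane. -/
def planeNorm (v : Fin 2 → ℤ) : ℤ := |v 0| + |v 1|

theorem mul_mem_vertexGroupFour :
    ∀ s ∈ vertexGroupFour, ∀ t ∈ vertexGroupFour, s * t ∈ vertexGroupFour := by
  decide +kernel

theorem mul_mem_vertexGroupSix :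
    ∀ s ∈ vertexGroupSix, ∀ t ∈ vertexGroupSix, s * t ∈ vertexGroupSix := by
  decide +kernel

theorem one_mem_vertexGroupFour : (1 : Matrix (Fin 2) (Fin 2) ℤ) ∈ vertexGroupFour := by
  decide +kernel

theorem exists_inv_amalgamFactors :
    ∀ s ∈ amalgamFactors, ∃ t ∈ amalgamFactors, s * t = 1 ∧ t * s = 1 := by
  decide +kernel

/-- One half of the ping-pong: the elements outside the amalgamated subgroup are signed permutation
matrices that exchange the two pairs of opposite quadrants. -/
theorem vertexGroupFour_mulVec {s : Matrix (Fin 2) (Fin 2) ℤ} (hs : s ∈ vertexGroupFour)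
    (hs' : s ∉ vertexGroupSix) {v : Fin 2 → ℤ} (hv : v 0 * v 1 < 0) :
    0 < (s.mulVec v) 0 * (s.mulVec v) 1 ∧ planeNorm (s.mulVec v) = planeNorm v := by
  simp only [vertexGroupFour, List.mem_cons, List.not_mem_nil, or_false] at hs
  rcases hs with rfl | rfl | rfl | rfl | rfl | rfl | rfl | rfl <;>
    first
    | exact absurd (by decide +kernel) hs'
    | (simp [planeNorm, Matrix.mulVec, dotProduct, Fin.sum_univ_two]; try constructor) <;>
        first | done | nlinarith

/-- The other half: when the coordinates have equal signs, their sum has no cancellation, which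
accounts for the growth of the norm. -/
theorem vertexGroupSix_mulVec {s : Matrix (Fin 2) (Fin 2) ℤ} (hs : s ∈ vertexGroupSix)
    (hs' : s ∉ vertexGroupFour) {v : Fin 2 → ℤ} (hv : 0 < v 0 * v 1) :
    (s.mulVec v) 0 * (s.mulVec v) 1 < 0 ∧ planeNorm v < planeNorm (s.mulVec v) := by
  simp only [vertexGroupSix, List.mem_cons, List.not_mem_nil, or_false] at hs
  rcases hs with rfl | rfl | rfl | rfl | rfl | rfl | rfl | rfl | rfl | rfl | rfl | rfl <;>
    first
    | exact absurd (by decide +kernel) hs'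
    | (simp [planeNorm, Matrix.mulVec, dotProduct, Fin.sum_univ_two]
       rcases mul_pos_iff.1 hv with ⟨h0, h1⟩ | ⟨h0, h1⟩ <;> constructor <;>
        first | nlinarith | grind)

/-- An alternating word with at least one letter outside the amalgamated subgroup moves some
vector of norm two, and its value there shows the vertex group of the first letter. -/
theorem exists_mulVec_of_isChain (l : List (Matrix (Fin 2) (Fin 2) ℤ)) :
    ∀ s : Matrix (Fin 2) (Fin 2) ℤ, (∀ t ∈ s :: l, t ∈ amalgamFactors) →
      ¬ (s ∈ vertexGroupFour ∧ s ∈ vertexGroupSix) →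
      (s :: l).IsChain (fun a b => a * b ∉ amalgamFactors) →
      ∃ v : Fin 2 → ℤ, planeNorm v = 2 ∧
        ((s ∈ vertexGroupFour ∧ 0 < ((s :: l).prod.mulVec v) 0 * ((s :: l).prod.mulVec v) 1 ∧
            2 ≤ planeNorm ((s :: l).prod.mulVec v) ∧
            (l ≠ [] → 2 < planeNorm ((s :: l).prod.mulVec v))) ∨
          (s ∈ vertexGroupSix ∧ ((s :: l).prod.mulVec v) 0 * ((s :: l).prod.mulVec v) 1 < 0 ∧
            2 < planeNorm ((s :: l).prod.mulVec v))) := by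
  induction l with
  | nil =>
    intro s hs hc _
    have hs := hs s (by simp)
    rw [amalgamFactors, List.mem_append] at hs
    by_cases h4 : s ∈ vertexGroupFour
    -- `(1, -1)`, and `(1, 1)` in the other case, has norm two and lies in the region on which the
    -- factor of `s` acts.
    · have := vertexGroupFour_mulVec h4 (fun h => hc ⟨h4, h⟩) (v := ![1, -1]) (by simp)
      exact ⟨![1, -1], by decide, Or.inl ⟨h4, by simpa using this.1, by
        simp only [List.prod_cons, List.prod_nil, mul_one, this.2]; decide, by simp⟩⟩
    · have := vertexGroupSix_mulVec (hs.resolve_left h4) h4 (v := ![1, 1]) (by simp)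
      exact ⟨![1, 1], by decide, Or.inr ⟨hs.resolve_left h4, by simpa using this.1, by
        simpa [planeNorm] using this.2⟩⟩
  | cons t l ih =>
    intro s hs hc hchain
    rw [List.isChain_cons_cons] at hchain
    have hsF := hs s (by simp)
    have htF := hs t (by simp)
    rw [amalgamFactors, List.mem_append] at hsF htF
    have h4 : s ∈ vertexGroupFour → t ∉ vertexGroupFour := fun h h' =>
      hchain.1 (List.mem_append_left _ (mul_mem_vertexGroupFour _ h _ h'))
    have h6 : s ∈ vertexGroupSix → t ∉ vertexGroupSix := fun h h' =>
      hchain.1 (List.mem_append_right _ (mul_mem_vertexGroupSix _ h _ h'))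
    -- The letter `t` is outside the amalgamated subgroup, since it avoids every factor that
    -- contains `s`.
    obtain ⟨v, hv, H⟩ := ih t (fun u hu => hs u (List.mem_cons_of_mem _ hu)) (by tauto) hchain.2
    refine ⟨v, hv, ?_⟩
    rw [List.prod_cons, ← Matrix.mulVec_mulVec]
    rcases H with ⟨ht, hpos, hn, -⟩ | ⟨ht, hneg, hn⟩
    · have hs4 : s ∉ vertexGroupFour := fun h => h4 h ht
      have := vertexGroupSix_mulVec (hsF.resolve_left hs4) hs4 hpos
      exact Or.inr ⟨hsF.resolve_left hs4, this.1, by omega⟩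
    · have hs6 : s ∉ vertexGroupSix := fun h => h6 h ht
      have := vertexGroupFour_mulVec (hsF.resolve_right hs6) hs6 hneg
      exact Or.inl ⟨hsF.resolve_right hs6, this.1, by omega, fun _ => by omega⟩

/-- The word moves some vector of norm two to one of larger norm. A first letter in both factors is
impossible: its product with the next letter would stay in a factor. -/
theorem prod_ne_one_of_isChain {s t : Matrix (Fin 2) (Fin 2) ℤ}
    {l : List (Matrix (Fin 2) (Fin 2) ℤ)} (hF : ∀ u ∈ s :: t :: l, u ∈ amalgamFactors)
    (hl : (s :: t :: l).IsChain (fun a b => a * b ∉ amalgamFactors)) :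
    (s :: t :: l).prod ≠ 1 := by
  intro h1
  have hst := (List.isChain_cons_cons.1 hl).1
  have hc : ¬ (s ∈ vertexGroupFour ∧ s ∈ vertexGroupSix) := fun h => by
    have ht := hF t (by simp)
    rw [amalgamFactors, List.mem_append] at ht
    exact hst (List.mem_append.2 (ht.imp (mul_mem_vertexGroupFour _ h.1 _)
      (mul_mem_vertexGroupSix _ h.2 _)))
  obtain ⟨v, hv, H⟩ := exists_mulVec_of_isChain (t :: l) s hF hc hl
  rw [h1, Matrix.one_mulVec] at H
  rcases H with ⟨-, -, -, h⟩ | ⟨-, -, h⟩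
  · exact absurd (h (by simp)) (by omega)
  · omega

/-- A nontrivial word over the factors with product `1` has two neighbours that lie in a common
factor. -/
theorem exists_split_of_prod_eq_one {l : List (Matrix (Fin 2) (Fin 2) ℤ)}
    (hF : ∀ u ∈ l, u ∈ amalgamFactors) (hlen : 2 ≤ l.length) (h1 : l.prod = 1) :
    ∃ l₁ s t l₂, l = l₁ ++ s :: t :: l₂ ∧ s * t ∈ amalgamFactors := by
  by_contra! H
  match l, hlen with
  | s :: t :: l, _ =>
    refine prod_ne_one_of_isChain hF (List.isChain_iff_forall_rel_of_append_cons_cons.2 ?_) h1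
    intro a b l₁ l₂ h
    exact H l₁ a b l₂ h

/-! ### Runs of automata as paths over lists of transitions -/

/-- The matrix of a letter; an `ε`-transition contributes the identity. -/
def letterGL : Option Letter → GL (Fin 2) ℤ := fun o => (o.map Letter.toGL).getD 1

/-- `Run E p g q`: some path from `p` to `q` along transitions in `E` spells the matrix `g`. -/
inductive Run (E : List (ℕ × Option Letter × ℕ)) : ℕ → GL (Fin 2) ℤ → ℕ → Prop
  | nil (p : ℕ) : Run E p 1 p
  | snoc {p q r : ℕ} {g : GL (Fin 2) ℤ} {o : Option Letter} :
      Run E p g q → (q, o, r) ∈ E → Run E p (g * letterGL o) r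

theorem Run.single {E : List (ℕ × Option Letter × ℕ)} {p q : ℕ} {o : Option Letter}
    (h : (p, o, q) ∈ E) : Run E p (letterGL o) q := by
  simpa using (Run.nil p).snoc h

theorem Run.trans {E : List (ℕ × Option Letter × ℕ)} {p q r : ℕ} {g h : GL (Fin 2) ℤ}
    (hpq : Run E p g q) (hqr : Run E q h r) : Run E p (g * h) r := by
  induction hqr with
  | nil => simpa using hpq
  | snoc _ he ih => rw [← mul_assoc]; exact ih.snoc he

namespace Automaton

/-- The transitions between actual states. -/
def edges (𝒜 : Automaton) : List (ℕ × Option Letter × ℕ) :=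
  𝒜.transitions.filter fun t => t.1 < 𝒜.numStates ∧ t.2.2 < 𝒜.numStates

/-- The actual states among the initial ones. -/
def starts (𝒜 : Automaton) : List ℕ := 𝒜.start.filter fun p => p < 𝒜.numStates

/-- The actual states among the accepting ones. -/
def accepts (𝒜 : Automaton) : List ℕ := 𝒜.accept.filter fun p => p < 𝒜.numStates

theorem mem_edges {𝒜 : Automaton} {t : ℕ × Option Letter × ℕ} :
    t ∈ 𝒜.edges ↔ t ∈ 𝒜.transitions ∧ t.1 < 𝒜.numStates ∧ t.2.2 < 𝒜.numStates := by
  simp [edges]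

theorem mem_starts {𝒜 : Automaton} {p : ℕ} :
    p ∈ 𝒜.starts ↔ p ∈ 𝒜.start ∧ p < 𝒜.numStates := by
  simp [starts]

theorem mem_accepts {𝒜 : Automaton} {p : ℕ} :
    p ∈ 𝒜.accepts ↔ p ∈ 𝒜.accept ∧ p < 𝒜.numStates := by
  simp [accepts]

theorem exists_isPath_iff_run {𝒜 : Automaton} {p q : Fin 𝒜.numStates} {g : GL (Fin 2) ℤ} :
    (∃ x, 𝒜.toεNFA.IsPath p q x ∧ wordToGL x.reduceOption = g) ↔ Run 𝒜.edges p g q := by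
  constructor
  · rintro ⟨x, hx, rfl⟩
    induction hx with
    | nil => exact Run.nil _
    | cons t s u a x hstep _ ih =>
      have he : ((s : ℕ), a, (t : ℕ)) ∈ 𝒜.edges := mem_edges.2 ⟨hstep, s.2, t.2⟩
      have := (Run.single he).trans ih
      cases a <;> simpa [wordToGL, letterGL] using this
  · intro h
    generalize hp : (p : ℕ) = p' at h
    generalize hq : (q : ℕ) = q' at h
    induction h generalizing q with
    | nil =>
      obtain rfl : p = q := Fin.ext (hp.trans hq.symm)
      exact ⟨[], εNFA.IsPath.nil _, by simp [wordToGL]⟩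
    | @snoc r _ g o _ he ih =>
      subst hp hq
      obtain ⟨he, hr, -⟩ := mem_edges.1 he
      obtain ⟨x, hx, rfl⟩ := ih (q := ⟨r, hr⟩) rfl
      refine ⟨x ++ [o], (εNFA.isPath_append _).2 ⟨_, hx, εNFA.IsPath.singleton _ he⟩, ?_⟩
      cases o <;> simp [List.reduceOption_append, wordToGL, letterGL]

/-- From here on automata enter only through lists of natural numbers and transitions, over which
bounded quantification is primitive recursive. -/
theorem mem_subset_iff {𝒜 : Automaton} {g : GL (Fin 2) ℤ} :
    g ∈ 𝒜.subset ↔ ∃ p ∈ 𝒜.starts, ∃ q ∈ 𝒜.accepts, Run 𝒜.edges p g q := by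
  constructor
  · rintro ⟨w, hw, rfl⟩
    obtain ⟨p, q, x, hp, hq, hx, hpath⟩ := (εNFA.mem_accepts_iff_exists_path _).1 hw
    exact ⟨p, mem_starts.2 ⟨hp, p.2⟩, q, mem_accepts.2 ⟨hq, q.2⟩,
      exists_isPath_iff_run.1 ⟨x, hpath, by rw [hx]⟩⟩
  · rintro ⟨p, hp, q, hq, h⟩
    obtain ⟨hp, hp'⟩ := mem_starts.1 hp
    obtain ⟨hq, hq'⟩ := mem_accepts.1 hq
    obtain ⟨x, hx, rfl⟩ := exists_isPath_iff_run (p := ⟨p, hp'⟩) (q := ⟨q, hq'⟩) |>.2 h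
    exact ⟨_, (εNFA.mem_accepts_iff_exists_path _).2 ⟨_, _, x, hp, hq, rfl, hx⟩, rfl⟩

end Automaton

/-! ### The decision problem and orbits of nonsingular matrices -/

/-- An input of the decision problem: two automata and two matrices. -/
abbrev Instance : Type :=
  Automaton × Automaton × Matrix (Fin 2) (Fin 2) ℤ × Matrix (Fin 2) (Fin 2) ℤ

/-- The decision problem: `A₁ M₁ A₂ = M₂` for some members of the two regular subsets. -/
def Solvable (x : Instance) : Prop :=
  ∃ A₁ ∈ x.1.subset, ∃ A₂ ∈ x.2.1.subset,
    (A₁ : Matrix (Fin 2) (Fin 2) ℤ) * x.2.2.1 * (A₂ : Matrix (Fin 2) (Fin 2) ℤ) = x.2.2.2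

/-- A configuration: which automaton is running, its state, and a matrix. -/
abbrev Config : Type := Bool × ℕ × Matrix (Fin 2) (Fin 2) ℤ

/-- The matrix of a letter, as a plain matrix. -/
def letterMatrix (o : Option Letter) : Matrix (Fin 2) (Fin 2) ℤ := letterGL o

/-- `M = G * K` for an integer matrix `G`, for nonsingular `K` expressed by divisibility. -/
def LeftMultiple (M K : Matrix (Fin 2) (Fin 2) ℤ) : Prop :=
  ∀ i j, K.det ∣ (M * K.adjugate) i j

theorem leftMultiple_iff {M K : Matrix (Fin 2) (Fin 2) ℤ} (hK : K.det ≠ 0) :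
    LeftMultiple M K ↔ ∃ G, M = G * K := by
  constructor
  · intro h
    choose G hG using h
    refine ⟨Matrix.of G, ?_⟩
    have h1 : M * K.adjugate = K.det • Matrix.of G := by
      ext i j
      simpa using hG i j
    have h2 : K.det • M = K.det • (Matrix.of G * K) := by
      calc K.det • M = M * K.adjugate * K := by
            rw [Matrix.mul_assoc, Matrix.adjugate_mul, Matrix.mul_smul, Matrix.mul_one]
        _ = _ := by rw [h1, Matrix.smul_mul]
    exact smul_right_injective _ hK h2
  · rintro ⟨G, rfl⟩ i j
    rw [Matrix.mul_assoc, Matrix.mul_adjugate, Matrix.mul_smul, Matrix.mul_one]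
    exact ⟨G i j, by simp⟩

/-- For nonsingular matrices: `M` and `K` are in one orbit of `GL(2, ℤ)` acting from the left. -/
def SameOrbit (M K : Matrix (Fin 2) (Fin 2) ℤ) : Prop := LeftMultiple M K ∧ LeftMultiple K M

/-- If `M = G K` and `K = H M`, then `(G H - 1) M = 0`, and nonsingularity of `M` makes `G` and `H`
inverse. This makes the orbit relation a test of divisibilities. -/
theorem sameOrbit_iff {M K : Matrix (Fin 2) (Fin 2) ℤ} (hM : M.det ≠ 0) (hK : K.det ≠ 0) :
    SameOrbit M K ↔ ∃ G : GL (Fin 2) ℤ, M = (G : Matrix (Fin 2) (Fin 2) ℤ) * K := by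
  rw [SameOrbit, leftMultiple_iff hK, leftMultiple_iff hM]
  constructor
  · rintro ⟨⟨G, hG⟩, ⟨H, hH⟩⟩
    have h1 : G * H = 1 := by
      have h2 : G.det * H.det = 1 := by
        have h3 : M.det = G.det * H.det * M.det := by
          conv_lhs => rw [hG, hH]
          simp only [Matrix.det_mul, mul_assoc]
        exact mul_right_cancel₀ hM (by rw [one_mul]; exact h3.symm)
      have h3 : (G * H - 1) * M = 0 := by
        rw [sub_mul, one_mul, mul_assoc, ← hH, ← hG, sub_self]
      have h4 : (G * H - 1) * M * M.adjugate = 0 := by rw [h3, zero_mul]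
      rw [mul_assoc, Matrix.mul_adjugate, Matrix.mul_smul, mul_one, smul_eq_zero] at h4
      exact sub_eq_zero.1 (h4.resolve_left hM)
    exact ⟨⟨G, H, h1, mul_eq_one_comm.1 h1⟩, hG⟩
  · rintro ⟨G, rfl⟩
    refine ⟨⟨_, rfl⟩, ⟨((G⁻¹ : GL (Fin 2) ℤ) : Matrix (Fin 2) (Fin 2) ℤ), ?_⟩⟩
    rw [← mul_assoc, ← Units.val_mul, inv_mul_cancel, Units.val_one, one_mul]

theorem eq_one_of_mul_eq_right {G M : Matrix (Fin 2) (Fin 2) ℤ} (hM : M.det ≠ 0)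
    (h : G * M = M) : G = 1 := by
  have h3 : (G - 1) * M = 0 := by rw [sub_mul, one_mul, h, sub_self]
  have h4 : (G - 1) * M * M.adjugate = 0 := by rw [h3, zero_mul]
  rw [mul_assoc, Matrix.mul_adjugate, Matrix.mul_smul, mul_one, smul_eq_zero] at h4
  exact sub_eq_zero.1 (h4.resolve_left hM)

theorem letterMatrix_mem_amalgamFactors (o : Option Letter) :
    letterMatrix o ∈ amalgamFactors := by
  revert o
  decide +kernel

theorem one_mem_amalgamFactors : (1 : Matrix (Fin 2) (Fin 2) ℤ) ∈ amalgamFactors :=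
  List.mem_append_left _ one_mem_vertexGroupFour

/-! ### Labelled paths and saturation -/

/-- `LabelPath P x l y`: the edges in `P` form a path from `x` to `y` with labels `l`. -/
inductive LabelPath (P : List (Config × Matrix (Fin 2) (Fin 2) ℤ × Config)) :
    Config → List (Matrix (Fin 2) (Fin 2) ℤ) → Config → Prop
  | nil (x : Config) : LabelPath P x [] x
  | cons {x y z : Config} {s : Matrix (Fin 2) (Fin 2) ℤ} {l : List (Matrix (Fin 2) (Fin 2) ℤ)} :
      (x, s, y) ∈ P → LabelPath P y l z → LabelPath P x (s :: l) z

namespace LabelPath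

variable {P : List (Config × Matrix (Fin 2) (Fin 2) ℤ × Config)}

theorem single {x y : Config} {s : Matrix (Fin 2) (Fin 2) ℤ} (h : (x, s, y) ∈ P) :
    LabelPath P x [s] y := cons h (nil _)

theorem append {x y z : Config} {l m : List (Matrix (Fin 2) (Fin 2) ℤ)}
    (h : LabelPath P x l y) (h' : LabelPath P y m z) : LabelPath P x (l ++ m) z := by
  induction h with
  | nil => exact h'
  | cons he _ ih => exact cons he (ih h')

theorem append_split {x z : Config} {l m : List (Matrix (Fin 2) (Fin 2) ℤ)}
    (h : LabelPath P x (l ++ m) z) : ∃ y, LabelPath P x l y ∧ LabelPath P y m z := by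
  induction l generalizing x with
  | nil => exact ⟨x, nil x, h⟩
  | cons s l ih =>
    cases h with
    | cons he h =>
      obtain ⟨y, h1, h2⟩ := ih h
      exact ⟨y, cons he h1, h2⟩

theorem forall_label {x z : Config} {l : List (Matrix (Fin 2) (Fin 2) ℤ)}
    {p : Matrix (Fin 2) (Fin 2) ℤ → Prop} (hP : ∀ e ∈ P, p e.2.1) (h : LabelPath P x l z) :
    ∀ s ∈ l, p s := by
  induction h with
  | nil => simp
  | cons he _ ih => exact List.forall_mem_cons.2 ⟨hP _ he, ih⟩

/-- Saturation: in a set of edges that is closed under composition of labels inside the factors,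
a path whose labels multiply to `1` can be shortened to one edge. -/
theorem one_mem_of_prod_eq_one (hF : ∀ e ∈ P, e.2.1 ∈ amalgamFactors)
    (hP : ∀ e ∈ P, ∀ f ∈ P, e.2.2 = f.1 → e.2.1 * f.2.1 ∈ amalgamFactors →
      (e.1, e.2.1 * f.2.1, f.2.2) ∈ P) (n : ℕ) :
    ∀ {x z : Config} {l : List (Matrix (Fin 2) (Fin 2) ℤ)}, l.length = n + 1 →
      LabelPath P x l z → l.prod = 1 → (x, 1, z) ∈ P := by
  induction n with
  | zero =>
    intro x z l hl h h1
    obtain ⟨s, rfl⟩ := List.length_eq_one_iff.1 hl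
    cases h with
    | cons he h =>
      cases h
      rw [List.prod_singleton] at h1
      rwa [h1] at he
  | succ n ih =>
    intro x z l hl h h1
    -- Closure replaces the edges labelled `s` and `t` by one labelled `s * t`; the product is
    -- unchanged and the path is one edge shorter. The length is never zero, so an edge is left at
    -- the end.
    obtain ⟨l₁, s, t, l₂, rfl, hst⟩ :=
      exists_split_of_prod_eq_one (h.forall_label hF) (by omega) h1
    obtain ⟨y, h₁, h₂⟩ := h.append_split
    cases h₂ with
    | cons he h₂ =>
      cases h₂ with
      | cons hf h₂ =>
        refine ih (l := l₁ ++ (s * t) :: l₂) (by simp at hl ⊢; omega)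
          (h₁.append (cons (hP _ he _ hf rfl hst) h₂)) ?_
        rw [← h1]
        simp [mul_assoc]

end LabelPath

theorem exists_GL_of_forall_mem {l : List (Matrix (Fin 2) (Fin 2) ℤ)}
    (h : ∀ s ∈ l, s ∈ amalgamFactors) :
    ∃ G : GL (Fin 2) ℤ, (G : Matrix (Fin 2) (Fin 2) ℤ) = l.prod := by
  induction l with
  | nil => exact ⟨1, rfl⟩
  | cons s l ih =>
    obtain ⟨G, hG⟩ := ih fun t ht => h t (List.mem_cons_of_mem _ ht)
    obtain ⟨t, -, h1, h2⟩ := exists_inv_amalgamFactors s (h s (by simp))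
    exact ⟨⟨s, t, h1, h2⟩ * G, by simp [hG]⟩

/-! ### Refutations and their soundness -/

/-- Data for a proof of unsolvability: a list of ranked matrices and a list of labelled edges. -/
abbrev Refutation : Type :=
  List (ℕ × Matrix (Fin 2) (Fin 2) ℤ) × List (Config × Matrix (Fin 2) (Fin 2) ℤ × Config)

/-- The edges of a refutation are labelled by members of the factors and closed under composition
inside the factors. -/
def Saturated (P : List (Config × Matrix (Fin 2) (Fin 2) ℤ × Config)) : Prop :=
  (∀ e ∈ P, e.2.1 ∈ amalgamFactors) ∧
    ∀ e ∈ P, ∀ f ∈ P, e.2.2 = f.1 → e.2.1 * f.2.1 ∈ amalgamFactors →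
      (e.1, e.2.1 * f.2.1, f.2.2) ∈ P

/-- A matrix of rank zero is `M₂` or not in its orbit, and the transitions of the second automaton
are available at it. -/
def RankZeroValid (x : Instance) (c : Refutation) (M : Matrix (Fin 2) (Fin 2) ℤ) : Prop :=
  (M = x.2.2.2 ∨ ¬ SameOrbit M x.2.2.2) ∧
    ∀ t ∈ x.2.1.edges, (∃ m ∈ c.1, m.2 = M * letterMatrix t.2.1) ∧
      ((true, t.1, M), 1, (true, t.2.2, M * letterMatrix t.2.1)) ∈ c.2

/-- A matrix of positive rank is brought to smaller rank by a member of the factors. -/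
def RankSuccValid (x : Instance) (c : Refutation) (m : ℕ × Matrix (Fin 2) (Fin 2) ℤ) : Prop :=
  ∃ m' ∈ c.1, ∃ s ∈ amalgamFactors, m'.1 < m.1 ∧ m.2 = s * m'.2 ∧
    ∀ q ∈ List.range x.2.1.numStates, ((true, q, m.2), s, (true, q, m'.2)) ∈ c.2

/-- The conditions under which a refutation shows that an instance has no solution. -/
def Refutes (x : Instance) (c : Refutation) : Prop :=
  Saturated c.2 ∧
  (∀ t ∈ x.1.edges, ((false, t.1, 0), letterMatrix t.2.1, (false, t.2.2, 0)) ∈ c.2) ∧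
  (∀ p ∈ x.1.accepts, ∀ q ∈ x.2.1.starts, ((false, p, 0), 1, (true, q, x.2.2.1)) ∈ c.2) ∧
  (∃ m ∈ c.1, m.2 = x.2.2.1) ∧
  (∀ m ∈ c.1, (m.1 = 0 ∧ RankZeroValid x c m.2) ∨ RankSuccValid x c m) ∧
  ∀ p ∈ x.1.starts, ∀ q ∈ x.2.1.accepts, ((false, p, 0), 1, (true, q, x.2.2.2)) ∉ c.2

theorem exists_labelPath_of_run {x : Instance} {c : Refutation}
    (hc : ∀ t ∈ x.1.edges, ((false, t.1, 0), letterMatrix t.2.1, (false, t.2.2, 0)) ∈ c.2)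
    {p q : ℕ} {g : GL (Fin 2) ℤ} (h : Run x.1.edges p g q) :
    ∃ l, LabelPath c.2 (false, p, 0) l (false, q, 0) ∧ l.prod = g := by
  induction h with
  | nil => exact ⟨[], LabelPath.nil _, rfl⟩
  | snoc _ he ih =>
    obtain ⟨l, hl, h1⟩ := ih
    exact ⟨_, hl.append (LabelPath.single (hc _ he)), by simp [h1, letterMatrix]⟩

/-- Ranks strictly decrease along the steps, so the descent from any listed matrix ends at rank
zero. -/
theorem exists_labelPath_rank_zero {x : Instance} {c : Refutation}
    (hc : ∀ m ∈ c.1, (m.1 = 0 ∧ RankZeroValid x c m.2) ∨ RankSuccValid x c m)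
    {q : ℕ} (hq : q < x.2.1.numStates) (n : ℕ) : ∀ m ∈ c.1, m.1 = n →
      ∃ H l, RankZeroValid x c H ∧ LabelPath c.2 (true, q, m.2) l (true, q, H) ∧
        m.2 = l.prod * H := by
  induction n using Nat.strong_induction_on with
  | _ n ih =>
    rintro m hm rfl
    rcases hc m hm with ⟨-, h⟩ | ⟨m', hm', s, -, hlt, hs, he⟩
    · exact ⟨m.2, [], h, LabelPath.nil _, by simp⟩
    · obtain ⟨H, l, hH, hl, h1⟩ := ih _ hlt m' hm' rfl
      exact ⟨H, s :: l, hH, LabelPath.cons (he q (List.mem_range.2 hq)) hl, by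
        rw [hs, h1, List.prod_cons, mul_assoc]⟩

/-- The invariant of the simulation: after each letter the matrix `H` is replaced by `H` times the
letter and brought back to rank zero, and the left factors split off on the way are recorded as
labels. -/
theorem exists_labelPath_of_run_snd {x : Instance} {c : Refutation}
    (hc : ∀ m ∈ c.1, (m.1 = 0 ∧ RankZeroValid x c m.2) ∨ RankSuccValid x c m)
    {p q : ℕ} (hp : p < x.2.1.numStates) (hM : ∃ m ∈ c.1, m.2 = x.2.2.1) {g : GL (Fin 2) ℤ}
    (h : Run x.2.1.edges p g q) :
    ∃ H l, RankZeroValid x c H ∧ LabelPath c.2 (true, p, x.2.2.1) l (true, q, H) ∧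
      x.2.2.1 * (g : Matrix (Fin 2) (Fin 2) ℤ) = l.prod * H := by
  induction h with
  | nil =>
    obtain ⟨m, hm, h⟩ := hM
    simpa [h] using exists_labelPath_rank_zero hc hp _ m hm rfl
  | @snoc q r g o _ he ih =>
    obtain ⟨H, l, hH, hl, h1⟩ := ih
    obtain ⟨⟨m, hm, hm'⟩, hedge⟩ := hH.2 _ he
    obtain ⟨K, l', hK, hl', h2⟩ :=
      exists_labelPath_rank_zero hc (Automaton.mem_edges.1 he).2.2 _ m hm rfl
    rw [hm'] at hl' h2
    refine ⟨K, _, hK, hl.append (LabelPath.cons hedge hl'), ?_⟩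
    rw [Units.val_mul, ← mul_assoc, h1, List.prod_append, List.prod_cons, one_mul, mul_assoc,
      mul_assoc, ← h2]
    rfl

theorem not_solvable_of_refutes {x : Instance} {c : Refutation}
    (hM₂ : x.2.2.2.det ≠ 0) (hc : Refutes x c) : ¬ Solvable x := by
  rintro ⟨A₁, h₁, A₂, h₂, h⟩
  obtain ⟨hsat, hE₁, hJ, hS, hL, hfin⟩ := hc
  obtain ⟨p, hp, q, hq, hrun₁⟩ := Automaton.mem_subset_iff.1 h₁
  obtain ⟨p', hp', q', hq', hrun₂⟩ := Automaton.mem_subset_iff.1 h₂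
  obtain ⟨l₁, hl₁, hA₁⟩ := exists_labelPath_of_run hE₁ hrun₁
  obtain ⟨H, l₂, hH, hl₂, hA₂⟩ :=
    exists_labelPath_of_run_snd hL (Automaton.mem_starts.1 hp').2 hS hrun₂
  obtain ⟨G, hG⟩ := exists_GL_of_forall_mem (hl₂.forall_label hsat.1)
  have hprod : ((A₁ * G : GL (Fin 2) ℤ) : Matrix (Fin 2) (Fin 2) ℤ) * H = x.2.2.2 := by
    rw [Units.val_mul, hG, mul_assoc, ← hA₂, ← mul_assoc, h]
  have hHdet : H.det ≠ 0 := by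
    rintro h0
    rw [← hprod, Matrix.det_mul, h0, mul_zero] at hM₂
    exact hM₂ rfl
  -- `H` is in the orbit of `M₂`, whose only admissible rank-zero member is `M₂` itself. Cancelling
  -- `M₂` then gives `A₁ * G = 1`, so the whole path has label product `1`.
  obtain rfl : H = x.2.2.2 := hH.1.resolve_right fun hn => hn <|
    (sameOrbit_iff hHdet hM₂).2 ⟨(A₁ * G)⁻¹, by
      rw [← hprod, ← mul_assoc, ← Units.val_mul, inv_mul_cancel, Units.val_one, one_mul]⟩
  have h1 := eq_one_of_mul_eq_right hM₂ hprod
  refine hfin p hp q' hq' (LabelPath.one_mem_of_prod_eq_one hsat.1 hsat.2 _ (by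
    rw [List.length_append, List.length_cons, ← add_assoc])
    (hl₁.append (LabelPath.cons (hJ q hq p' hp') hl₂)) ?_)
  rw [List.prod_append, List.prod_cons, one_mul, hA₁, ← hG, ← h1, Units.val_mul]

/-! ### Descent to finitely many orbit representatives -/

/-- Every matrix in the list has rank zero and lies in `Z`, or is brought to smaller rank by a
member of the factors. -/
def IsDescent (Z : Set (Matrix (Fin 2) (Fin 2) ℤ)) (L : List (ℕ × Matrix (Fin 2) (Fin 2) ℤ)) :
    Prop :=
  ∀ m ∈ L, (m.1 = 0 ∧ m.2 ∈ Z) ∨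
    ∃ m' ∈ L, ∃ s ∈ amalgamFactors, m'.1 < m.1 ∧ m.2 = s * m'.2

/-- The matrix descends to `Z` by left multiplications with members of the factors. -/
def HasDescent (Z : Set (Matrix (Fin 2) (Fin 2) ℤ)) (B : Matrix (Fin 2) (Fin 2) ℤ) : Prop :=
  ∃ L, IsDescent Z L ∧ ∃ m ∈ L, m.2 = B

theorem IsDescent.append {Z : Set (Matrix (Fin 2) (Fin 2) ℤ)}
    {L L' : List (ℕ × Matrix (Fin 2) (Fin 2) ℤ)} (h : IsDescent Z L) (h' : IsDescent Z L') :
    IsDescent Z (L ++ L') := by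
  intro m hm
  rcases List.mem_append.1 hm with hm | hm
  · refine (h m hm).imp id ?_
    rintro ⟨m', hm', H⟩
    exact ⟨m', List.mem_append_left _ hm', H⟩
  · refine (h' m hm).imp id ?_
    rintro ⟨m', hm', H⟩
    exact ⟨m', List.mem_append_right _ hm', H⟩

/-- Finitely many descents can be put into one list. -/
theorem exists_isDescent_of_forall {Z : Set (Matrix (Fin 2) (Fin 2) ℤ)}
    (l : List (Matrix (Fin 2) (Fin 2) ℤ)) (h : ∀ B ∈ l, HasDescent Z B) :
    ∃ L, IsDescent Z L ∧ ∀ B ∈ l, ∃ m ∈ L, m.2 = B := by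
  induction l with
  | nil => exact ⟨[], by simp [IsDescent], by simp⟩
  | cons B l ih =>
    obtain ⟨L, hL, hl⟩ := ih fun C hC => h C (List.mem_cons_of_mem _ hC)
    obtain ⟨L', hL', m, hm, hB⟩ := h B (by simp)
    refine ⟨L' ++ L, hL'.append hL, List.forall_mem_cons.2
      ⟨⟨m, List.mem_append_left _ hm, hB⟩, fun C hC => ?_⟩⟩
    obtain ⟨m, hm, hC⟩ := hl C hC
    exact ⟨m, List.mem_append_right _ hm, hC⟩

namespace HasDescent

variable {Z : Set (Matrix (Fin 2) (Fin 2) ℤ)} {B : Matrix (Fin 2) (Fin 2) ℤ}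

theorem of_mem (h : B ∈ Z) : HasDescent Z B :=
  ⟨[(0, B)], by simpa [IsDescent] using h, _, List.mem_singleton_self _, rfl⟩

theorem mul {s : Matrix (Fin 2) (Fin 2) ℤ} (hs : s ∈ amalgamFactors) (h : HasDescent Z B) :
    HasDescent Z (s * B) := by
  obtain ⟨L, hL, m, hm, rfl⟩ := h
  refine ⟨(m.1 + 1, s * m.2) :: L, ?_, _, List.mem_cons_self, rfl⟩
  refine List.forall_mem_cons.2 ⟨Or.inr ⟨m, List.mem_cons_of_mem _ hm, s, hs, by simp, rfl⟩, ?_⟩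
  intro k hk
  refine (hL k hk).imp id ?_
  rintro ⟨m', hm', H⟩
  exact ⟨m', List.mem_cons_of_mem _ hm', H⟩

theorem S_mul (h : HasDescent Z B) :
    HasDescent Z ((ModularGroup.S : Matrix (Fin 2) (Fin 2) ℤ) * B) := by
  rw [ModularGroup.coe_S]
  exact h.mul (by decide +kernel)

/-- `T = S⁻¹ R` is a product of two members of the factors, hence costs two descent steps. -/
theorem T_mul (h : HasDescent Z B) :
    HasDescent Z ((ModularGroup.T : Matrix (Fin 2) (Fin 2) ℤ) * B) := by
  have e : (ModularGroup.T : Matrix (Fin 2) (Fin 2) ℤ) = !![0, 1; -1, 0] * !![0, -1; 1, 1] := by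
    rw [ModularGroup.coe_T]; decide +kernel
  rw [e, mul_assoc]
  exact (h.mul (by decide +kernel)).mul (by decide +kernel)

theorem fixedDetMatrix {m : ℤ} (hm : m ≠ 0)
    (h0 : ∀ A ∈ FixedDetMatrices.reps m, HasDescent Z A.1) (A : FixedDetMatrix (Fin 2) ℤ m) :
    HasDescent Z A.1 := by
  induction A using FixedDetMatrices.induction_on hm with
  | h0 A h1 h2 h3 h4 => exact h0 A ⟨h1, h2, h3, h4⟩
  | hS B h => exact h.S_mul
  | hT B h => exact h.T_mul

theorem sl_mul (h : HasDescent Z B) {G : Matrix (Fin 2) (Fin 2) ℤ} (hG : G.det = 1) :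
    HasDescent Z (G * B) := by
  suffices H : ∀ A : FixedDetMatrix (Fin 2) ℤ 1, HasDescent Z (A.1 * B) from H ⟨G, hG⟩
  intro A
  induction A using FixedDetMatrices.induction_on one_ne_zero with
  | h0 A h1 h2 h3 h4 =>
    rw [FixedDetMatrices.reps_one_id A h1 h2 h4]
    simpa using h
  | hS C ih =>
    rw [FixedDetMatrices.smul_coe, mul_assoc]
    exact ih.S_mul
  | hT C ih =>
    rw [FixedDetMatrices.smul_coe, mul_assoc]
    exact ih.T_mul

/-- For determinant `-1`, left multiplication by `N` leads to `SL(2, ℤ)`, and a second one, a single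
descent step, undoes it. -/
theorem gl_mul (h : HasDescent Z B) (G : GL (Fin 2) ℤ) :
    HasDescent Z ((G : Matrix (Fin 2) (Fin 2) ℤ) * B) := by
  have hG : IsUnit (G : Matrix (Fin 2) (Fin 2) ℤ).det :=
    (Matrix.isUnit_iff_isUnit_det _).1 G.isUnit
  rcases Int.isUnit_iff.1 hG with hG | hG
  · exact h.sl_mul hG
  · have h1 : HasDescent Z (!![1, 0; 0, -1] * (G : Matrix (Fin 2) (Fin 2) ℤ) * B) :=
      h.sl_mul (by rw [Matrix.det_mul, hG]; simp)
    have h2 := h1.mul (s := !![1, 0; 0, -1]) (by decide +kernel)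
    rw [← mul_assoc, ← mul_assoc] at h2
    have e : (!![1, 0; 0, -1] : Matrix (Fin 2) (Fin 2) ℤ) * !![1, 0; 0, -1] = 1 := by
      decide +kernel
    rwa [e, one_mul] at h2

end HasDescent

/-- The representatives of the orbits of determinant `±d`, where `K` represents its own orbit. -/
def orbitReps (d : ℤ) (K : Matrix (Fin 2) (Fin 2) ℤ) : Set (Matrix (Fin 2) (Fin 2) ℤ) :=
  {M | (M.det = d ∨ M.det = -d) ∧ (M = K ∨ ¬ SameOrbit M K ∧
    (M ∈ Subtype.val '' FixedDetMatrices.reps d ∨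
      M ∈ Subtype.val '' FixedDetMatrices.reps (-d)))}

theorem finite_orbitReps (d : ℤ) (K : Matrix (Fin 2) (Fin 2) ℤ) : (orbitReps d K).Finite := by
  have h (d : ℤ) : (Subtype.val '' FixedDetMatrices.reps (m := d)).Finite :=
    (Set.toFinite (FixedDetMatrices.reps d)).image _
  refine ((Set.finite_singleton K).union ((h d).union (h (-d)))).subset ?_
  rintro M ⟨-, h | ⟨-, h⟩⟩
  · exact Or.inl h
  · exact Or.inr h

/-- Reduction by `S` and `T` ends at one of the standard representatives; one that lies in the orbit
of `K` descends further to `K`. -/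
theorem hasDescent_orbitReps {d : ℤ} (hd : d ≠ 0) {K : Matrix (Fin 2) (Fin 2) ℤ}
    (hK : K.det ≠ 0) {M : Matrix (Fin 2) (Fin 2) ℤ} (hM : M.det = d ∨ M.det = -d) :
    HasDescent (orbitReps d K) M := by
  have key : ∀ A : Matrix (Fin 2) (Fin 2) ℤ, (A.det = d ∨ A.det = -d) →
      (A ∈ Subtype.val '' FixedDetMatrices.reps d ∨
        A ∈ Subtype.val '' FixedDetMatrices.reps (-d)) → HasDescent (orbitReps d K) A := by
    intro A hA hrep
    by_cases hAK : SameOrbit A K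
    · have hA0 : A.det ≠ 0 := by omega
      obtain ⟨G, rfl⟩ := (sameOrbit_iff hA0 hK).1 hAK
      have hG : IsUnit (G : Matrix (Fin 2) (Fin 2) ℤ).det :=
        (Matrix.isUnit_iff_isUnit_det _).1 G.isUnit
      rw [Matrix.det_mul] at hA
      suffices h : K ∈ orbitReps d K from (HasDescent.of_mem h).gl_mul G
      -- `K` has determinant `±d` because it shares its orbit with a matrix of determinant `±d`.
      refine ⟨?_, Or.inl rfl⟩
      rcases Int.isUnit_iff.1 hG with hG | hG <;> rw [hG] at hA <;> omega
    · exact HasDescent.of_mem ⟨hA, Or.inr ⟨hAK, hrep⟩⟩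
  rcases hM with hM | hM
  · exact HasDescent.fixedDetMatrix hd
      (fun A hA => key A.1 (Or.inl A.2) (Or.inl ⟨A, hA, rfl⟩)) ⟨M, hM⟩
  · exact HasDescent.fixedDetMatrix (neg_ne_zero.2 hd)
      (fun A hA => key A.1 (Or.inr A.2) (Or.inr ⟨A, hA, rfl⟩)) ⟨M, hM⟩

theorem det_letterMatrix (o : Option Letter) :
    (letterMatrix o).det = 1 ∨ (letterMatrix o).det = -1 := by
  revert o
  decide +kernel

/-! ### Completeness of refutations -/

/-- The labelled edges between configurations that have a meaning in terms of runs. -/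
inductive Derivable (x : Instance) : Config → Matrix (Fin 2) (Fin 2) ℤ → Config → Prop
  | fst {p q : ℕ} {g : GL (Fin 2) ℤ} : Run x.1.edges p g q →
      Derivable x (false, p, 0) g (false, q, 0)
  | snd {p q : ℕ} {g : GL (Fin 2) ℤ} {M M' s : Matrix (Fin 2) (Fin 2) ℤ} :
      Run x.2.1.edges p g q → M * (g : Matrix (Fin 2) (Fin 2) ℤ) = s * M' →
      Derivable x (true, p, M) s (true, q, M')
  | jump {p q p' q' : ℕ} {g h : GL (Fin 2) ℤ} {M s : Matrix (Fin 2) (Fin 2) ℤ} :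
      Run x.1.edges p g p' → p' ∈ x.1.accepts → q' ∈ x.2.1.starts → Run x.2.1.edges q' h q →
      (g : Matrix (Fin 2) (Fin 2) ℤ) * x.2.2.1 * (h : Matrix (Fin 2) (Fin 2) ℤ) = s * M →
      Derivable x (false, p, 0) s (true, q, M)

/-- Runs concatenate, so edges with a meaning are closed under composition. The control passes only
from the first automaton to the second, which leaves four cases. -/
theorem Derivable.trans {x : Instance} {a b c : Config} {s t : Matrix (Fin 2) (Fin 2) ℤ}
    (h : Derivable x a s b) (h' : Derivable x b t c) : Derivable x a (s * t) c := by
  cases h with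
  | fst h =>
    cases h' with
    | fst h' => rw [← Units.val_mul]; exact .fst (h.trans h')
    | jump h1 h2 h3 h4 h5 =>
      exact .jump (h.trans h1) h2 h3 h4 (by rw [Units.val_mul, mul_assoc _ t, ← h5]; noncomm_ring)
  | snd h e =>
    cases h' with
    | snd h' e' => exact .snd (h.trans h') (by
        rw [Units.val_mul, ← mul_assoc, e, mul_assoc, e', mul_assoc])
  | jump h1 h2 h3 h4 h5 =>
    cases h' with
    | snd h' e' => exact .jump h1 h2 h3 (h4.trans h') (by
        rw [Units.val_mul, ← mul_assoc, h5, mul_assoc, e', mul_assoc])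

/-- The refutation consists of all derivable edges with labels in the factors between finitely many
configurations. It need not be computed, only exist, so derivability may be decided classically
here. -/
theorem exists_refutes {x : Instance} (hM₁ : x.2.2.1.det ≠ 0) (hM₂ : x.2.2.2.det ≠ 0)
    (hx : ¬ Solvable x) : ∃ c, Refutes x c := by
  classical
  set Z := orbitReps x.2.2.1.det x.2.2.2 with hZ
  have hfin : Z.Finite := finite_orbitReps _ _
  -- Descents are needed only from `M₁` and from each representative times one letter.
  obtain ⟨L, hL, hLmem⟩ := exists_isDescent_of_forall (Z := Z)
    (x.2.2.1 :: hfin.toFinset.toList.flatMap fun M =>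
      (Finset.univ : Finset (Option Letter)).toList.map fun o => M * letterMatrix o) (by
    refine List.forall_mem_cons.2 ⟨hasDescent_orbitReps hM₁ hM₂ (Or.inl rfl), ?_⟩
    intro B hB
    simp only [List.mem_flatMap, List.mem_map, Finset.mem_toList, Set.Finite.mem_toFinset] at hB
    obtain ⟨M, hM, o, -, rfl⟩ := hB
    refine hasDescent_orbitReps hM₁ hM₂ ?_
    rw [Matrix.det_mul]
    have h1 := hM.1
    rcases det_letterMatrix o with h2 | h2 <;> rw [h2] <;> omega)
  have hL₁ : ∃ m ∈ L, m.2 = x.2.2.1 := hLmem _ (by simp)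
  have hL₂ : ∀ M ∈ Z, ∀ o, ∃ m ∈ L, m.2 = M * letterMatrix o := fun M hM o =>
    hLmem _ (List.mem_cons_of_mem _ (List.mem_flatMap.2 ⟨M, by simpa using hM,
      List.mem_map.2 ⟨o, by simp, rfl⟩⟩))
  let V : List Config := ((List.range x.1.numStates).map fun p => (false, p, 0)) ++
    (List.range x.2.1.numStates).flatMap fun q => L.map fun m => (true, q, m.2)
  have hV₁ : ∀ p, p < x.1.numStates → ((false, p, 0) : Config) ∈ V := fun p hp =>
    List.mem_append_left _ (List.mem_map.2 ⟨p, List.mem_range.2 hp, rfl⟩)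
  have hV₂ : ∀ q, q < x.2.1.numStates → ∀ m ∈ L, ((true, q, m.2) : Config) ∈ V :=
    fun q hq m hm => List.mem_append_right _
      (List.mem_flatMap.2 ⟨q, List.mem_range.2 hq, List.mem_map.2 ⟨m, hm, rfl⟩⟩)
  let P : List (Config × Matrix (Fin 2) (Fin 2) ℤ × Config) :=
    (V ×ˢ (amalgamFactors ×ˢ V)).filter fun e => Derivable x e.1 e.2.1 e.2.2
  have hP : ∀ {a s b}, (a, s, b) ∈ P ↔
      (a ∈ V ∧ s ∈ amalgamFactors ∧ b ∈ V) ∧ Derivable x a s b := by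
    intro a s b
    simp [P]
  refine ⟨(L, P), ⟨?_, ?_⟩, ?_, ?_, hL₁, ?_, ?_⟩
  · rintro ⟨a, s, b⟩ h
    exact (hP.1 h).1.2.1
  · rintro ⟨a, s, b⟩ h ⟨b', t, c⟩ h' hb hst
    dsimp only at hb hst
    subst hb
    exact hP.2 ⟨⟨(hP.1 h).1.1, hst, (hP.1 h').1.2.2⟩, (hP.1 h).2.trans (hP.1 h').2⟩
  · rintro ⟨p, o, q⟩ ht
    have ht' := Automaton.mem_edges.1 ht
    exact hP.2 ⟨⟨hV₁ _ ht'.2.1, letterMatrix_mem_amalgamFactors _, hV₁ _ ht'.2.2⟩,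
      .fst (Run.single ht)⟩
  · intro p hp q hq
    obtain ⟨m, hm, hm'⟩ := hL₁
    refine hP.2 ⟨⟨hV₁ _ (Automaton.mem_accepts.1 hp).2, one_mem_amalgamFactors, ?_⟩,
      .jump (Run.nil _) hp hq (Run.nil _) (by simp)⟩
    rw [← hm']
    exact hV₂ _ (Automaton.mem_starts.1 hq).2 m hm
  · intro m hm
    rcases hL m hm with ⟨h0, hmZ⟩ | ⟨m', hm', s, hs, hlt, he⟩
    · refine Or.inl ⟨h0, hmZ.2.imp id And.left, ?_⟩
      rintro ⟨p, o, q⟩ ht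
      have ht' := Automaton.mem_edges.1 ht
      obtain ⟨k, hk, hk'⟩ := hL₂ _ hmZ o
      refine ⟨⟨k, hk, hk'⟩, hP.2 ⟨⟨hV₂ _ ht'.2.1 m hm, one_mem_amalgamFactors, ?_⟩,
        .snd (Run.single ht) (by rw [one_mul]; rfl)⟩⟩
      dsimp only
      rw [← hk']
      exact hV₂ _ ht'.2.2 k hk
    · refine Or.inr ⟨m', hm', s, hs, hlt, he, fun q hq => ?_⟩
      rw [List.mem_range] at hq
      exact hP.2 ⟨⟨hV₂ _ hq m hm, hs, hV₂ _ hq m' hm'⟩, .snd (Run.nil _) (by simpa using he)⟩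
  · intro p hp q hq h
    -- An edge from the first automaton to the second can only be a `jump`; with label `1` and
    -- target `M₂` it is a solution.
    generalize hs : (1 : Matrix (Fin 2) (Fin 2) ℤ) = s at h
    cases (hP.1 h).2 with
    | jump h1 h2 h3 h4 h5 =>
      subst hs
      exact hx ⟨_, Automaton.mem_subset_iff.2 ⟨p, hp, _, h2, h1⟩, _,
        Automaton.mem_subset_iff.2 ⟨_, h3, q, hq, h4⟩, by rw [h5, one_mul]⟩

/-! ### Certificates of solvability -/

/-- The initial configurations: a state to start from, with the empty product. -/
def InitialConfig (x : Instance) (a : Config) : Prop :=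
  a.1 = false ∧ a.2.1 ∈ x.1.starts ∧ a.2.2 = 1

/-- One step of the two automata, which multiplies the product by a letter, or by `M₁` where
the first automaton hands over to the second. -/
def ConfigStep (x : Instance) (a b : Config) : Prop :=
  (∃ t ∈ x.1.edges, a = (false, t.1, a.2.2) ∧ b = (false, t.2.2, a.2.2 * letterMatrix t.2.1)) ∨
  (∃ t ∈ x.2.1.edges, a = (true, t.1, a.2.2) ∧ b = (true, t.2.2, a.2.2 * letterMatrix t.2.1)) ∨
  (a.1 = false ∧ a.2.1 ∈ x.1.accepts ∧ b.1 = true ∧ b.2.1 ∈ x.2.1.starts ∧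
    b.2.2 = a.2.2 * x.2.2.1)

/-- Every ranked configuration in the list is initial or reached from one of smaller rank. -/
def IsTrace (x : Instance) (D : List (ℕ × Config)) : Prop :=
  ∀ e ∈ D, InitialConfig x e.2 ∨ ∃ e' ∈ D, e'.1 < e.1 ∧ ConfigStep x e'.2 e.2

/-- The list is a trace that contains a configuration with product `M₂` where the second automaton
accepts. -/
def Solves (x : Instance) (D : List (ℕ × Config)) : Prop :=
  IsTrace x D ∧ ∃ e ∈ D, e.2.1 = true ∧ e.2.2.1 ∈ x.2.1.accepts ∧ e.2.2.2 = x.2.2.2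

/-- What the configurations that can be reached say about runs of the automata. -/
def Reached (x : Instance) (a : Config) : Prop :=
  ∃ p ∈ x.1.starts, ∃ g : GL (Fin 2) ℤ,
    (a.1 = false ∧ Run x.1.edges p g a.2.1 ∧ a.2.2 = g) ∨
    (a.1 = true ∧ ∃ q ∈ x.1.accepts, Run x.1.edges p g q ∧ ∃ p' ∈ x.2.1.starts,
      ∃ h : GL (Fin 2) ℤ, Run x.2.1.edges p' h a.2.1 ∧
        a.2.2 = (g : Matrix (Fin 2) (Fin 2) ℤ) * x.2.2.1 * (h : Matrix (Fin 2) (Fin 2) ℤ))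

theorem Reached.step {x : Instance} {a b : Config} (h : Reached x a) (hab : ConfigStep x a b) :
    Reached x b := by
  obtain ⟨p, hp, g, h⟩ := h
  rcases hab with ⟨⟨q, o, r⟩, ht, ha, rfl⟩ | ⟨⟨q, o, r⟩, ht, ha, rfl⟩ | ⟨ha, hq, hb, hb', hb''⟩
  · rw [ha] at h
    obtain ⟨-, h, hg⟩ | ⟨h, -⟩ := h
    · exact ⟨p, hp, _, Or.inl ⟨rfl, h.snoc ht, by
        rw [Units.val_mul, ← hg]; rfl⟩⟩
    · cases h
  · rw [ha] at h
    obtain ⟨h, -⟩ | ⟨-, q', hq', hrun, p', hp', k, h, hk⟩ := h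
    · cases h
    · refine ⟨p, hp, g, Or.inr ⟨rfl, q', hq', hrun, p', hp', _, h.snoc ht, ?_⟩⟩
      rw [Units.val_mul, ← mul_assoc, ← hk]
      rfl
  · obtain ⟨-, h, hg⟩ | ⟨h, -⟩ := h
    · exact ⟨p, hp, g, Or.inr ⟨hb, _, hq, h, _, hb', 1, Run.nil _, by
        rw [hb'', hg, Units.val_one, mul_one]⟩⟩
    · rw [ha] at h
      cases h

/-- The strict decrease of ranks excludes circular justifications, so strong induction on the rank
applies. -/
theorem IsTrace.reached {x : Instance} {D : List (ℕ × Config)} (hD : IsTrace x D) (n : ℕ) :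
    ∀ e ∈ D, e.1 = n → Reached x e.2 := by
  induction n using Nat.strong_induction_on with
  | _ n ih =>
    rintro e he rfl
    rcases hD e he with ⟨h1, h2, h3⟩ | ⟨e', he', hlt, hstep⟩
    · exact ⟨_, h2, 1, Or.inl ⟨h1, Run.nil _, h3⟩⟩
    · exact (ih _ hlt e' he' rfl).step hstep

theorem solvable_of_solves {x : Instance} {D : List (ℕ × Config)} (h : Solves x D) :
    Solvable x := by
  obtain ⟨hD, e, he, h1, h2, h3⟩ := h
  obtain ⟨p, hp, g, ⟨h, -⟩ | ⟨-, q, hq, hrun, p', hp', k, hk, e3⟩⟩ := hD.reached _ e he rfl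
  · rw [h] at h1
    cases h1
  · exact ⟨g, Automaton.mem_subset_iff.2 ⟨p, hp, q, hq, hrun⟩, k,
      Automaton.mem_subset_iff.2 ⟨p', hp', _, h2, hk⟩, by rw [← e3, h3]⟩

/-- The configuration is in some trace. -/
def HasTrace (x : Instance) (a : Config) : Prop := ∃ D, IsTrace x D ∧ ∃ e ∈ D, e.2 = a

theorem HasTrace.step {x : Instance} {a b : Config} (h : HasTrace x a) (hab : ConfigStep x a b) :
    HasTrace x b := by
  obtain ⟨D, hD, e, he, rfl⟩ := h
  refine ⟨(e.1 + 1, b) :: D, List.forall_mem_cons.2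
    ⟨Or.inr ⟨e, List.mem_cons_of_mem _ he, by simp, hab⟩, fun k hk => ?_⟩, _,
    List.mem_cons_self, rfl⟩
  refine (hD k hk).imp id ?_
  rintro ⟨e', he', H⟩
  exact ⟨e', List.mem_cons_of_mem _ he', H⟩

theorem HasTrace.run_fst {x : Instance} {p q : ℕ} {g : GL (Fin 2) ℤ} (hp : p ∈ x.1.starts)
    (h : Run x.1.edges p g q) : HasTrace x (false, q, g) := by
  induction h with
  | nil =>
    exact ⟨[(0, (false, p, 1))], by simp [IsTrace, InitialConfig, hp], _,
      List.mem_singleton_self _, rfl⟩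
  | snoc _ he ih => exact ih.step (Or.inl ⟨_, he, rfl, rfl⟩)

theorem HasTrace.run_snd {x : Instance} {p q : ℕ} {M : Matrix (Fin 2) (Fin 2) ℤ}
    {g : GL (Fin 2) ℤ} (hM : HasTrace x (true, p, M)) (h : Run x.2.1.edges p g q) :
    HasTrace x (true, q, M * (g : Matrix (Fin 2) (Fin 2) ℤ)) := by
  induction h with
  | nil => simpa using hM
  | snoc _ he ih =>
    exact ih.step (Or.inr (Or.inl ⟨_, he, rfl, by rw [Units.val_mul, ← mul_assoc]; rfl⟩))

theorem exists_solves_iff {x : Instance} : (∃ D, Solves x D) ↔ Solvable x := by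
  constructor
  · rintro ⟨D, hD⟩
    exact solvable_of_solves hD
  · rintro ⟨A₁, h₁, A₂, h₂, h⟩
    obtain ⟨p, hp, q, hq, hrun₁⟩ := Automaton.mem_subset_iff.1 h₁
    obtain ⟨p', hp', q', hq', hrun₂⟩ := Automaton.mem_subset_iff.1 h₂
    have hjump : HasTrace x (true, p', (A₁ : Matrix (Fin 2) (Fin 2) ℤ) * x.2.2.1) :=
      (HasTrace.run_fst hp hrun₁).step (Or.inr (Or.inr ⟨rfl, hq, rfl, hp', rfl⟩))
    obtain ⟨D, hD, e, he, hea⟩ := hjump.run_snd hrun₂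
    exact ⟨D, hD, e, he, by rw [hea], by rw [hea]; exact hq', by rw [hea]; exact h⟩

theorem exists_refutes_iff {x : Instance} (hM₁ : x.2.2.1.det ≠ 0) (hM₂ : x.2.2.2.det ≠ 0) :
    (∃ c, Refutes x c) ↔ ¬ Solvable x :=
  ⟨fun ⟨_, hc⟩ => not_solvable_of_refutes hM₂ hc, exists_refutes hM₁ hM₂⟩

/-! ### Primitive recursiveness of the certificate checks -/

section PrimrecCalculus

variable {α β γ : Type*} [Primcodable α] [Primcodable β] [Primcodable γ]

theorem Primrec.fst_comp {f : α → β × γ} (hf : Primrec f) : Primrec fun a => (f a).1 :=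
  Primrec.fst.comp hf

theorem Primrec.snd_comp {f : α → β × γ} (hf : Primrec f) : Primrec fun a => (f a).2 :=
  Primrec.snd.comp hf

theorem Primrec.matrix_mul_comp {f g : α → Matrix (Fin 2) (Fin 2) ℤ} (hf : Primrec f)
    (hg : Primrec g) : Primrec fun a => f a * g a :=
  Primrec.matrix_mul.comp hf hg

theorem PrimrecPred.eq_comp {f g : α → β} (hf : Primrec f) (hg : Primrec g) :
    PrimrecPred fun a => f a = g a :=
  Primrec.eq.comp hf hg

theorem PrimrecPred.lt_comp {f g : α → ℕ} (hf : Primrec f) (hg : Primrec g) :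
    PrimrecPred fun a => f a < g a :=
  Primrec.nat_lt.comp hf hg

attribute [fun_prop] Primrec Primrec.id Primrec.const Primrec.comp Primrec.fst_comp
  Primrec.snd_comp Primrec.pair Primrec.matrix_mul_comp Primrec.matrix_adjugate Primrec.matrix_det

end PrimrecCalculus

theorem Primrec.letterMatrix : Primrec letterMatrix := Primrec.dom_finite _

theorem Automaton.primrec_equivProd : Primrec Automaton.equivProd := Primrec.of_equiv

theorem Automaton.primrec_numStates : Primrec Automaton.numStates :=
  (Primrec.fst.comp Automaton.primrec_equivProd).of_eq fun _ => rfl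

theorem Automaton.primrec_transitions : Primrec Automaton.transitions :=
  (Primrec.fst.comp (Primrec.snd.comp Automaton.primrec_equivProd)).of_eq fun _ => rfl

theorem Automaton.primrec_start : Primrec Automaton.start :=
  (Primrec.fst.comp (Primrec.snd.comp (Primrec.snd.comp Automaton.primrec_equivProd))).of_eq
    fun _ => rfl

theorem Automaton.primrec_accept : Primrec Automaton.accept :=
  (Primrec.snd.comp (Primrec.snd.comp (Primrec.snd.comp Automaton.primrec_equivProd))).of_eq
    fun _ => rfl

attribute [fun_prop] Primrec.letterMatrix Automaton.primrec_numStates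
  Automaton.primrec_transitions Automaton.primrec_start Automaton.primrec_accept

theorem Automaton.primrec_starts : Primrec Automaton.starts := by
  have h : PrimrecRel fun (p : ℕ) (𝒜 : Automaton) => p < 𝒜.numStates :=
    PrimrecPred.lt_comp (by fun_prop) (by fun_prop)
  exact h.listFilter.comp Automaton.primrec_start Primrec.id

theorem Automaton.primrec_accepts : Primrec Automaton.accepts := by
  have h : PrimrecRel fun (p : ℕ) (𝒜 : Automaton) => p < 𝒜.numStates :=
    PrimrecPred.lt_comp (by fun_prop) (by fun_prop)
  exact h.listFilter.comp Automaton.primrec_accept Primrec.id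

theorem Automaton.primrec_edges : Primrec Automaton.edges := by
  have h : PrimrecRel fun (t : ℕ × Option Letter × ℕ) (𝒜 : Automaton) =>
      t.1 < 𝒜.numStates ∧ t.2.2 < 𝒜.numStates :=
    PrimrecPred.and (PrimrecPred.lt_comp (by fun_prop) (by fun_prop))
      (PrimrecPred.lt_comp (by fun_prop) (by fun_prop))
  exact h.listFilter.comp Automaton.primrec_transitions Primrec.id

attribute [fun_prop] Automaton.primrec_starts Automaton.primrec_accepts Automaton.primrec_edges

section CertificatePredicates

variable {α : Type*} [Primcodable α]

theorem PrimrecPred.leftMultiple {f g : α → Matrix (Fin 2) (Fin 2) ℤ} (hf : Primrec f)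
    (hg : Primrec g) : PrimrecPred fun a => LeftMultiple (f a) (g a) := by
  have h (i j : Fin 2) : PrimrecPred fun a => (g a).det ∣ (f a * (g a).adjugate) i j :=
    PrimrecPred.int_dvd.comp (by fun_prop)
      ((Primrec.matrix_entry i j).comp (f := fun M : Matrix (Fin 2) (Fin 2) ℤ => M i j)
        (by fun_prop))
  exact (((h 0 0).and (h 0 1)).and ((h 1 0).and (h 1 1))).of_eq fun a => by
    simp only [LeftMultiple, Fin.forall_fin_two]

theorem PrimrecPred.saturated {f : α → List (Config × Matrix (Fin 2) (Fin 2) ℤ × Config)}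
    (hf : Primrec f) : PrimrecPred fun a => Saturated (f a) := by
  unfold Saturated
  refine .and (.forall_mem hf (.mem_list (.const _) (by fun_prop)))
    (.forall_mem hf (.forall_mem (by fun_prop) (.imp (.eq_comp (by fun_prop) (by fun_prop))
      (.imp (.mem_list (.const _) (by fun_prop)) (.mem_list (by fun_prop) (by fun_prop))))))

theorem PrimrecPred.rankZeroValid {f : α → Instance} {g : α → Refutation}
    {k : α → Matrix (Fin 2) (Fin 2) ℤ} (hf : Primrec f) (hg : Primrec g) (hk : Primrec k) :
    PrimrecPred fun a => RankZeroValid (f a) (g a) (k a) := by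
  unfold RankZeroValid SameOrbit
  exact .and
    (.or (.eq_comp (by fun_prop) (by fun_prop)) (.not (.and
      (.leftMultiple (by fun_prop) (by fun_prop)) (.leftMultiple (by fun_prop) (by fun_prop)))))
    (.forall_mem (by fun_prop) (.and
      (.exists_mem (by fun_prop) (.eq_comp (by fun_prop) (by fun_prop)))
      (.mem_list (by fun_prop) (by fun_prop))))

theorem PrimrecPred.rankSuccValid {f : α → Instance} {g : α → Refutation}
    {k : α → ℕ × Matrix (Fin 2) (Fin 2) ℤ} (hf : Primrec f) (hg : Primrec g) (hk : Primrec k) :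
    PrimrecPred fun a => RankSuccValid (f a) (g a) (k a) := by
  unfold RankSuccValid
  exact .exists_mem (by fun_prop) (.exists_mem (.const _) (.and
    (.lt_comp (by fun_prop) (by fun_prop)) (.and (.eq_comp (by fun_prop) (by fun_prop))
      (.forall_mem (Primrec.list_range.comp (by fun_prop))
        (.mem_list (by fun_prop) (by fun_prop))))))

theorem PrimrecPred.refutes {f : α → Instance} {g : α → Refutation} (hf : Primrec f)
    (hg : Primrec g) : PrimrecPred fun a => Refutes (f a) (g a) := by
  unfold Refutes
  exact .and (.saturated (by fun_prop)) <|
    .and (.forall_mem (by fun_prop) (.mem_list (by fun_prop) (by fun_prop))) <|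
    .and (.forall_mem (by fun_prop) (.forall_mem (by fun_prop)
      (.mem_list (by fun_prop) (by fun_prop)))) <|
    .and (.exists_mem (by fun_prop) (.eq_comp (by fun_prop) (by fun_prop))) <|
    .and (.forall_mem (by fun_prop) (.or (.and (.eq_comp (by fun_prop) (by fun_prop))
      (.rankZeroValid (by fun_prop) (by fun_prop) (by fun_prop)))
      (.rankSuccValid (by fun_prop) (by fun_prop) (by fun_prop)))) <|
    .forall_mem (by fun_prop) (.forall_mem (by fun_prop)
      (.not (.mem_list (by fun_prop) (by fun_prop))))

theorem PrimrecPred.initialConfig {f : α → Instance} {g : α → Config} (hf : Primrec f)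
    (hg : Primrec g) : PrimrecPred fun a => InitialConfig (f a) (g a) := by
  unfold InitialConfig
  exact .and (.eq_comp (by fun_prop) (by fun_prop)) (.and (.mem_list (by fun_prop) (by fun_prop))
    (.eq_comp (by fun_prop) (by fun_prop)))

theorem PrimrecPred.configStep {f : α → Instance} {g k : α → Config} (hf : Primrec f)
    (hg : Primrec g) (hk : Primrec k) : PrimrecPred fun a => ConfigStep (f a) (g a) (k a) := by
  unfold ConfigStep
  exact .or (.exists_mem (by fun_prop) (.and (.eq_comp (by fun_prop) (by fun_prop))
      (.eq_comp (by fun_prop) (by fun_prop)))) <|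
    .or (.exists_mem (by fun_prop) (.and (.eq_comp (by fun_prop) (by fun_prop))
      (.eq_comp (by fun_prop) (by fun_prop)))) <|
    .and (.eq_comp (by fun_prop) (by fun_prop)) <| .and (.mem_list (by fun_prop) (by fun_prop)) <|
    .and (.eq_comp (by fun_prop) (by fun_prop)) <| .and (.mem_list (by fun_prop) (by fun_prop)) <|
    .eq_comp (by fun_prop) (by fun_prop)

theorem PrimrecPred.solves {f : α → Instance} {g : α → List (ℕ × Config)} (hf : Primrec f)
    (hg : Primrec g) : PrimrecPred fun a => Solves (f a) (g a) := by
  unfold Solves IsTrace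
  exact .and (.forall_mem (by fun_prop) (.or (.initialConfig (by fun_prop) (by fun_prop))
      (.exists_mem (by fun_prop) (.and (.lt_comp (by fun_prop) (by fun_prop))
        (.configStep (by fun_prop) (by fun_prop) (by fun_prop))))))
    (.exists_mem (by fun_prop) (.and (.eq_comp (by fun_prop) (by fun_prop))
      (.and (.mem_list (by fun_prop) (by fun_prop)) (.eq_comp (by fun_prop) (by fun_prop)))))

end CertificatePredicates

/-! ### The search for certificates and the decision algorithm -/

/-- A predicate is decided by a search for certificates if, on a decidable domain, both the
predicate and its negation have decidable certificates. -/
theorem exists_computable_of_certificates {α β γ : Type*} [Primcodable α] [Primcodable β]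
    [Primcodable γ] {D p : α → Prop} {Y : α → β → Prop} {N : α → γ → Prop} (hD : PrimrecPred D)
    (hY : PrimrecRel Y) (hN : PrimrecRel N) (hpY : ∀ a, D a → ((∃ b, Y a b) ↔ p a))
    (hpN : ∀ a, D a → ((∃ c, N a c) ↔ ¬ p a)) :
    ∃ alg : α → Bool, Computable alg ∧ ∀ a, D a → (alg a = true ↔ p a) := by
  classical
  let test : α → β ⊕ γ → Option Bool := fun a c =>
    Sum.casesOn c (fun b => if Y a b then some true else none)
      (fun c => if N a c then some false else none)
  have htest : Primrec₂ test := by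
    refine Primrec.sumCasesOn Primrec.snd ?_ ?_
    · exact Primrec.ite (hY.comp (Primrec.fst.comp Primrec.fst) Primrec.snd) (Primrec.const _)
        (Primrec.const _)
    · exact Primrec.ite (hN.comp (Primrec.fst.comp Primrec.fst) Primrec.snd) (Primrec.const _)
        (Primrec.const _)
  -- Outside the domain no certificate need exist, so the search answers `false` at once; this makes
  -- it total.
  let search : α → ℕ → Option Bool := fun a n =>
    if D a then (Encodable.decode (α := β ⊕ γ) n).bind (test a) else some false
  have hsearch : Primrec₂ search :=
    Primrec.ite (hD.comp Primrec.fst)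
      (Primrec.option_bind (Primrec.decode.comp Primrec.snd)
        (htest.comp (Primrec.fst.comp Primrec.fst) Primrec.snd)) (Primrec.const _)
  have hmem : ∀ a c v, D a → test a c = some v → ∃ n v, v ∈ search a n := fun a c v hDa h =>
    ⟨Encodable.encode c, v, by simp only [search, if_pos hDa, Encodable.encodek]; exact h⟩
  have hdom : ∀ a, (Nat.rfindOpt (search a)).Dom := by
    intro a
    rw [Nat.rfindOpt_dom]
    by_cases hDa : D a
    · by_cases hp : p a
      · obtain ⟨b, hb⟩ := (hpY a hDa).2 hp
        exact hmem a (.inl b) true hDa (if_pos hb)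
      · obtain ⟨c, hc⟩ := (hpN a hDa).2 hp
        exact hmem a (.inr c) false hDa (if_pos hc)
    · exact ⟨0, false, if_neg hDa⟩
  refine ⟨fun a => (Nat.rfindOpt (search a)).get (hdom a), ?_, fun a hDa => ?_⟩
  · exact (Partrec.rfindOpt hsearch.to_comp).of_eq fun a => (Part.some_get _).symm
  · obtain ⟨n, hn⟩ := Nat.rfindOpt_spec (Part.get_mem (hdom a))
    dsimp only
    generalize (Nat.rfindOpt (search a)).get (hdom a) = v at hn ⊢
    simp only [search, if_pos hDa, Option.mem_def, Option.bind_eq_some_iff] at hn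
    obtain ⟨b | c, -, hc⟩ := hn
    · simp only [test] at hc
      split_ifs at hc with h
      simpa [← Option.some.inj hc] using (hpY a hDa).1 ⟨b, h⟩
    · simp only [test] at hc
      split_ifs at hc with h
      simpa [← Option.some.inj hc] using (hpN a hDa).1 ⟨c, h⟩

theorem mainTheorem5 :
    ∃ alg : Automaton × Automaton × Matrix (Fin 2) (Fin 2) ℤ × Matrix (Fin 2) (Fin 2) ℤ → Bool,
      Computable alg ∧
      ∀ (𝒜₁ 𝒜₂ : Automaton) (M₁ M₂ : Matrix (Fin 2) (Fin 2) ℤ), M₁.det ≠ 0 → M₂.det ≠ 0 →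
        (alg (𝒜₁, 𝒜₂, M₁, M₂) = true ↔
          ∃ A₁ ∈ 𝒜₁.subset, ∃ A₂ ∈ 𝒜₂.subset,
            (A₁ : Matrix (Fin 2) (Fin 2) ℤ) * M₁ * (A₂ : Matrix (Fin 2) (Fin 2) ℤ) = M₂) := by
  have hD : PrimrecPred fun x : Instance => x.2.2.1.det ≠ 0 ∧ x.2.2.2.det ≠ 0 :=
    .and (.not (.eq_comp (by fun_prop) (by fun_prop))) (.not (.eq_comp (by fun_prop) (by fun_prop)))
  obtain ⟨alg, halg, h⟩ := exists_computable_of_certificates (p := Solvable) (Y := Solves)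
    (N := Refutes) hD (PrimrecPred.solves (by fun_prop) (by fun_prop))
    (PrimrecPred.refutes (by fun_prop) (by fun_prop)) (fun _ _ => exists_solves_iff)
    (fun _ hx => exists_refutes_iff hx.1 hx.2)
  exact ⟨alg, halg, fun 𝒜₁ 𝒜₂ M₁ M₂ h₁ h₂ => h (𝒜₁, 𝒜₂, M₁, M₂) ⟨h₁, h₂⟩⟩
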